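/- Let $F$ be a field and $n\ge 1$. For $m\ge 0$ let $Q_m$ be the associative unital $F$-algebra generated by elements $r(A)$, $\emptyset\ne A\subseteq\{1,\dots,m\}$, subject to the relations $$r(A)\bigl(r(A\setminus\{i\})-r(A\setminus\{j\})\bigr)+\bigl(r(A\setminus\{i\})-r(A\setminus\{j\})\bigr)r(A\setminus\{i,j\})-r(A\setminus\{i\})^2+r(A\setminus\{j\})^2=0$$ for all $A\subseteq\{1,\dots,m\}$ and all distinct $i,j\in A$, where $r(\emptyset)=0$. Filter $Q_m$ by the subspaces $Q_{m,(j)}=\operatorname{span}\{r(A_1)\cdots r(A_l): l\ge 0,\ |A_1|+\dots+|A_l|\le j\}$, and put $Q_{m,(-1)}=0$. Let $gr\,Q_m=\bigoplus_{j\ge 0}Q_{m,(j)}/Q_{m,(j-1)}$ be the associated graded algebra, and let $\bar r(A)=r(A)+Q_{m,(|A|-1)}\in gr\,Q_m$. Let $Q_n(1)$ be the unital subalgebra of $Q_n$ generated by the $r(A)$ with $1\in A\subseteq\{1,\dots,n\}$, with the induced filtration $Q_n(1)\cap Q_{n,(j)}$. Let $gr\,Q_n(1)$ be its associated graded algebra,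 and for $1\in A$ write $\bar r(A)$ also for the class of $r(A)$ in degree $|A|$ of $gr\,Q_n(1)$. Let $F[\bar r(1)]$ denote the polynomial algebra over $F$ in one variable, named $\bar r(1)$, and let $*$ denote the free product (coproduct) of unital associative $F$-algebras. Lemma 3.5. $gr\,Q_n(1)$ is isomorphic, as an $F$-algebra, to $gr\,Q_{n-1}*F[\bar r(1)]$. More precisely, there is an isomorphism of $F$-algebras $$gr\,Q_{n-1}*F[\bar r(1)]\longrightarrow gr\,Q_n(1)$$ that sends $\bar r(A)\in gr\,Q_{n-1}$ to $\bar r(\{1\}\cup\{a+1: a\in A\})$ for every $\emptyset\ne A\subseteq\{1,\dots,n-1\}$, and the variable $\bar r(1)$ to the element $\bar r(\{1\})$. -/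

import Mathlib

open scoped DirectSum

noncomputable section

universe u

/-! ### Filtered algebras and associated graded algebras -/

/-- An increasing, exhaustive filtration `N₀ ⊆ N₁ ⊆ …` of an `F`-algebra `A` by subspaces with
`1 ∈ N₀` and `Nᵢ Nⱼ ⊆ Nᵢ₊ⱼ`. -/
structure AlgFiltration (F : Type u) [Field F] (A : Type u) [Ring A] [Algebra F A] where
  level : ℕ → Submodule F A
  mono : Monotone level
  one_mem : (1 : A) ∈ level 0
  mul_mem : ∀ {i j : ℕ} {a b : A}, a ∈ level i → b ∈ level j → a * b ∈ level (i + j)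
  exhaustive : ∀ a : A, ∃ j, a ∈ level j

namespace AlgFiltration

variable {F : Type u} [Field F] {A : Type u} [Ring A] [Algebra F A]

/-- The filtration induced on a subalgebra `S`: its levels are `S ∩ Nⱼ`. -/
def induced (N : AlgFiltration F A) (S : Subalgebra F A) : AlgFiltration F S where
  level j := (N.level j).comap S.val.toLinearMap
  mono _ _ h _ hx := N.mono h hx
  one_mem := N.one_mem
  mul_mem ha hb := N.mul_mem ha hb
  exhaustive a := N.exhaustive a

variable (N : AlgFiltration F A)

/-- The level just below `j`, that is `Nⱼ₋₁`, with `N₋₁ = 0`. -/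
def below : ℕ → Submodule F A
  | 0 => ⊥
  | j + 1 => N.level j

theorem mul_mem_below_left {i j : ℕ} {a b : A} (ha : a ∈ N.below i) (hb : b ∈ N.level j) :
    a * b ∈ N.below (i + j) := by
  cases i with
  | zero =>
    have h0 : a = 0 := by simpa [below] using ha
    rw [h0, zero_mul]
    exact Submodule.zero_mem _
  | succ i =>
    rw [Nat.succ_add]
    exact N.mul_mem ha hb

theorem mul_mem_below_right {i j : ℕ} {a b : A} (ha : a ∈ N.level i) (hb : b ∈ N.below j) :
    a * b ∈ N.below (i + j) := by
  cases j with
  | zero =>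
    have h0 : b = 0 := by simpa [below] using hb
    rw [h0, mul_zero]
    exact Submodule.zero_mem _
  | succ j => exact N.mul_mem ha hb

/-- The homogeneous component `Nⱼ / Nⱼ₋₁` of the associated graded algebra. -/
def Piece (j : ℕ) : Type u :=
  N.level j ⧸ (N.below j).submoduleOf (N.level j)

instance (j : ℕ) : AddCommGroup (N.Piece j) :=
  inferInstanceAs (AddCommGroup (N.level j ⧸ (N.below j).submoduleOf (N.level j)))

instance (j : ℕ) : Module F (N.Piece j) :=
  inferInstanceAs (Module F (N.level j ⧸ (N.below j).submoduleOf (N.level j)))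

/-- The class in `Nⱼ / Nⱼ₋₁` of an element of `Nⱼ`. -/
def cls (j : ℕ) (a : A) (h : a ∈ N.level j) : N.Piece j :=
  Submodule.Quotient.mk (p := (N.below j).submoduleOf (N.level j)) ⟨a, h⟩

/-- The product `(Nᵢ / Nᵢ₋₁) × (Nⱼ / Nⱼ₋₁) → Nᵢ₊ⱼ / Nᵢ₊ⱼ₋₁` induced by the product of `A`. -/
def pieceMul {i j : ℕ} (x : N.Piece i) (y : N.Piece j) : N.Piece (i + j) :=
  Quotient.map₂ (fun a b : _ => (⟨a.1 * b.1, N.mul_mem a.2 b.2⟩ : N.level (i + j)))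
    (by
      intro a a' ha b b' hb
      have ha2 : a.1 - a'.1 ∈ N.below i := 
        (Submodule.quotientRel_def ((N.below i).submoduleOf (N.level i))).mp ha
      have hb2 : b.1 - b'.1 ∈ N.below j := 
        (Submodule.quotientRel_def ((N.below j).submoduleOf (N.level j))).mp hb
      refine (Submodule.quotientRel_def
        ((N.below (i + j)).submoduleOf (N.level (i + j)))).mpr ?_
      change a.1 * b.1 - a'.1 * b'.1 ∈ N.below (i + j)
      have e : a.1 * b.1 - a'.1 * b'.1 = (a.1 - a'.1) * b.1 + a'.1 * (b.1 - b'.1) := by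
        rw [sub_mul, mul_sub]; abel
      rw [e]
      exact Submodule.add_mem _ (N.mul_mem_below_left ha2 b.2) (N.mul_mem_below_right a'.2 hb2))
    x y

theorem cls_surj {j : ℕ} (x : N.Piece j) : ∃ a h, x = N.cls j a h := by
  obtain ⟨⟨a, h⟩, rfl⟩ := Submodule.Quotient.mk_surjective _ x
  exact ⟨a, h, rfl⟩

theorem cls_mul {i j : ℕ} {a b : A} (ha : a ∈ N.level i) (hb : b ∈ N.level j) :
    N.pieceMul (N.cls i a ha) (N.cls j b hb) = N.cls (i + j) (a * b) (N.mul_mem ha hb) := rfl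

theorem mk_cls_eq {i j : ℕ} {a b : A} (ha : a ∈ N.level i) (hb : b ∈ N.level j)
    (hij : i = j) (hab : a = b) :
    (GradedMonoid.mk i (N.cls i a ha) : GradedMonoid N.Piece) =
      GradedMonoid.mk j (N.cls j b hb) := by
  subst hij
  subst hab
  rfl

instance : GradedMonoid.GOne N.Piece where
  one := N.cls 0 1 N.one_mem

instance : GradedMonoid.GMul N.Piece where
  mul := N.pieceMul

instance : GradedMonoid.GMonoid N.Piece where
  one_mul := by
    rintro ⟨i, x⟩
    obtain ⟨a, h, rfl⟩ := N.cls_surj x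
    exact N.mk_cls_eq (N.mul_mem N.one_mem h) h (zero_add _) (one_mul _)
  mul_one := by
    rintro ⟨i, x⟩
    obtain ⟨a, h, rfl⟩ := N.cls_surj x
    exact N.mk_cls_eq (N.mul_mem h N.one_mem) h (add_zero _) (mul_one _)
  mul_assoc := by
    rintro ⟨i, x⟩ ⟨j, y⟩ ⟨k, z⟩
    obtain ⟨a, ha, rfl⟩ := N.cls_surj x
    obtain ⟨b, hb, rfl⟩ := N.cls_surj y
    obtain ⟨c, hc, rfl⟩ := N.cls_surj z
    exact N.mk_cls_eq (N.mul_mem (N.mul_mem ha hb) hc) (N.mul_mem ha (N.mul_mem hb hc))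
      (add_assoc _ _ _) (mul_assoc _ _ _)

theorem natCast_mem (m : ℕ) : (m : A) ∈ N.level 0 := by
  rw [← nsmul_one]
  exact Submodule.smul_of_tower_mem _ m N.one_mem

theorem algebraMap_mem (c : F) : algebraMap F A c ∈ N.level 0 := by
  rw [Algebra.algebraMap_eq_smul_one]
  exact Submodule.smul_mem _ c N.one_mem

theorem cls_congr {j : ℕ} {a b : A} (ha : a ∈ N.level j) (hb : b ∈ N.level j) (hab : a = b) :
    N.cls j a ha = N.cls j b hb := by
  subst hab
  rfl

instance : DirectSum.GSemiring N.Piece where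
  mul_zero := by
    intro i j x
    obtain ⟨a, ha, rfl⟩ := N.cls_surj x
    exact N.cls_congr (N.mul_mem ha (Submodule.zero_mem _)) (Submodule.zero_mem _) (mul_zero a)
  zero_mul := by
    intro i j y
    obtain ⟨b, hb, rfl⟩ := N.cls_surj y
    exact N.cls_congr (N.mul_mem (Submodule.zero_mem _) hb) (Submodule.zero_mem _) (zero_mul b)
  mul_add := by
    intro i j x y z
    obtain ⟨a, ha, rfl⟩ := N.cls_surj x
    obtain ⟨b, hb, rfl⟩ := N.cls_surj y
    obtain ⟨c, hc, rfl⟩ := N.cls_surj z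
    exact N.cls_congr (N.mul_mem ha (Submodule.add_mem _ hb hc))
      (Submodule.add_mem _ (N.mul_mem ha hb) (N.mul_mem ha hc)) (mul_add a b c)
  add_mul := by
    intro i j x y z
    obtain ⟨a, ha, rfl⟩ := N.cls_surj x
    obtain ⟨b, hb, rfl⟩ := N.cls_surj y
    obtain ⟨c, hc, rfl⟩ := N.cls_surj z
    exact N.cls_congr (N.mul_mem (Submodule.add_mem _ ha hb) hc)
      (Submodule.add_mem _ (N.mul_mem ha hc) (N.mul_mem hb hc)) (add_mul a b c)
  natCast m := N.cls 0 m (N.natCast_mem m)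
  natCast_zero := N.cls_congr _ (Submodule.zero_mem _) Nat.cast_zero
  natCast_succ m :=
    N.cls_congr _ (Submodule.add_mem _ (N.natCast_mem m) N.one_mem) (Nat.cast_succ m)

instance : DirectSum.GAlgebra F N.Piece where
  toFun :=
    { toFun := fun c => N.cls 0 (algebraMap F A c) (N.algebraMap_mem c)
      map_zero' := N.cls_congr _ (Submodule.zero_mem _) (map_zero _)
      map_add' := fun c d => N.cls_congr _
        (Submodule.add_mem _ (N.algebraMap_mem c) (N.algebraMap_mem d)) (map_add _ c d) }
  map_one := N.cls_congr _ N.one_mem (map_one _)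
  map_mul c d := N.mk_cls_eq (N.algebraMap_mem (c * d))
    (N.mul_mem (N.algebraMap_mem c) (N.algebraMap_mem d)) rfl (map_mul _ c d)
  commutes := by
    rintro c ⟨i, x⟩
    obtain ⟨a, ha, rfl⟩ := N.cls_surj x
    exact N.mk_cls_eq (N.mul_mem (N.algebraMap_mem c) ha) (N.mul_mem ha (N.algebraMap_mem c))
      (add_comm _ _) (Algebra.commutes c a)
  smul_def := by
    rintro c ⟨i, x⟩
    obtain ⟨a, ha, rfl⟩ := N.cls_surj x
    exact N.mk_cls_eq (Submodule.smul_mem _ c ha) (N.mul_mem (N.algebraMap_mem c) ha)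
      (zero_add _).symm (Algebra.smul_def c a)

/-- The associated graded algebra `⨁ⱼ Nⱼ / Nⱼ₋₁`. -/
abbrev Gr : Type u := ⨁ j, N.Piece j

/-- The element `a + Nⱼ₋₁` of the associated graded algebra, for `a ∈ Nⱼ`. -/
def symbol (j : ℕ) (a : A) (h : a ∈ N.level j) : N.Gr :=
  DirectSum.of N.Piece j (N.cls j a h)

end AlgFiltration

/-! ### The free product of two algebras -/

namespace BinaryFreeProduct

/-- The two-member family consisting of `A` and `B`. -/
def Fam (A B : Type u) : Bool → Type u
  | false => A
  | true => B

variable (F : Type u) [Field F] (A B : Type u) [Semiring A] [Algebra F A] [Semiring B] [Algebra F B]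

instance : ∀ i, Semiring (Fam A B i)
  | false => inferInstanceAs (Semiring A)
  | true => inferInstanceAs (Semiring B)

instance : ∀ i, Algebra F (Fam A B i)
  | false => inferInstanceAs (Algebra F A)
  | true => inferInstanceAs (Algebra F B)

end BinaryFreeProduct

section

variable (F : Type u) [Field F] (A B : Type u) [Semiring A] [Algebra F A] [Semiring B] [Algebra F B]

/-- The free product `A * B` of two unital associative `F`-algebras. -/
abbrev FreeProd : Type u := LinearAlgebra.FreeProduct F (BinaryFreeProduct.Fam A B)

/-- The canonical homomorphism `A → A * B`. -/
def FreeProd.inl : A →ₐ[F] FreeProd F A B :=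
  LinearAlgebra.FreeProduct.ι F (BinaryFreeProduct.Fam A B) false

/-- The canonical homomorphism `B → A * B`. -/
def FreeProd.inr : B →ₐ[F] FreeProd F A B :=
  LinearAlgebra.FreeProduct.ι F (BinaryFreeProduct.Fam A B) true

end

/-! ### The algebras `Q_n` and `Q_n(1)`

The set `{1, …, n}` is modelled by `Fin n`, the element `1` being `0 : Fin n`. -/

namespace PseudoRoots

variable (F : Type u) [Field F] (n : ℕ)

/-- The nonempty subsets of `{1, …, n}`. -/
abbrev Gens : Type := {A : Finset (Fin n) // A.Nonempty}

/-- The tensor algebra `T(V)` on the space `V` with basis the symbols `v(A)`, `A` nonempty: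
the free associative algebra on these symbols. -/
abbrev T : Type u := FreeAlgebra F (Gens n)

variable {n} in
/-- The generator `v(A)`, with the convention `v(∅) = 0`. -/
def v (A : Finset (Fin n)) : T F n :=
  if h : A.Nonempty then FreeAlgebra.ι F ⟨A, h⟩ else 0

/-- The defining relations of `Q_n`, one for all distinct `i, j ∈ A`. -/
inductive Rel : T F n → T F n → Prop
  | mk (A : Finset (Fin n)) (i j : Fin n) (hi : i ∈ A) (hj : j ∈ A) (hij : i ≠ j) :
      Rel
        (v F A * (v F (A \ {i}) - v F (A \ {j}))
          + (v F (A \ {i}) - v F (A \ {j})) * v F (A \ {i, j})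
          - v F (A \ {i}) ^ 2 + v F (A \ {j}) ^ 2)
        0

/-- The quadratic algebra `Q_n`. -/
abbrev Q : Type u := RingQuot (Rel F n)

/-- The quotient map `T(V) → Q_n`. -/
def proj : T F n →ₐ[F] Q F n := RingQuot.mkAlgHom F (Rel F n)

variable {n} in
/-- The generator `r(A)` of `Q_n`. -/
def r (A : Finset (Fin n)) : Q F n := proj F n (v F A)

variable {n} in
/-- The degree `|A₁| + ⋯ + |A_l|` of a string of nonempty sets. -/
def degree (w : List (Gens n)) : ℕ := (w.map fun A => A.1.card).sum

/-- The subspace `T(V)_(j)` spanned by the products `v(A₁) ⋯ v(A_l)`, `l ≥ 0`, with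
`|A₁| + ⋯ + |A_l| ≤ j`. -/
def levelT (j : ℕ) : Submodule F (T F n) :=
  Submodule.span F {m | ∃ w : List (Gens n), degree w ≤ j ∧ m = (w.map fun A => v F A.1).prod}

theorem levelT_mul {i j : ℕ} {a b : T F n} (ha : a ∈ levelT F n i) (hb : b ∈ levelT F n j) :
    a * b ∈ levelT F n (i + j) := by
  have h := Submodule.mul_mem_mul ha hb
  rw [levelT, levelT, Submodule.span_mul_span] at h
  refine Submodule.span_mono ?_ h
  rintro _ ⟨_, ⟨w, hw, rfl⟩, _, ⟨w', hw', rfl⟩, rfl⟩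
  refine ⟨w ++ w', ?_, by simp⟩
  simp only [degree, List.map_append, List.sum_append] at *
  omega

theorem levelT_exhaustive (a : T F n) : ∃ j, a ∈ levelT F n j := by
  have mono : Monotone (levelT F n) := fun i j h =>
    Submodule.span_mono fun _ ⟨w, hw, e⟩ => ⟨w, hw.trans h, e⟩
  have hone : (1 : T F n) ∈ levelT F n 0 :=
    Submodule.subset_span ⟨[], by simp [degree], by simp⟩
  induction a using FreeAlgebra.induction with
  | grade0 c =>
    exact ⟨0, by rw [Algebra.algebraMap_eq_smul_one]; exact Submodule.smul_mem _ c hone⟩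
  | grade1 A =>
    exact ⟨A.1.card, Submodule.subset_span ⟨[A], by simp [degree], by simp [v, A.2]⟩⟩
  | mul a b ha hb =>
    obtain ⟨i, hi⟩ := ha
    obtain ⟨j, hj⟩ := hb
    exact ⟨i + j, levelT_mul F n hi hj⟩
  | add a b ha hb =>
    obtain ⟨i, hi⟩ := ha
    obtain ⟨j, hj⟩ := hb
    exact ⟨max i j, Submodule.add_mem _ (mono (le_max_left _ _) hi) (mono (le_max_right _ _) hj)⟩

/-- The filtration of `Q_n` by the images `Q_{n,(j)}` of the `T(V)_(j)`. -/
def filtQ : AlgFiltration F (Q F n) where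
  level j := (levelT F n j).map (proj F n).toLinearMap
  mono i j h := Submodule.map_mono
    (Submodule.span_mono fun _ ⟨w, hw, e⟩ => ⟨w, hw.trans h, e⟩)
  one_mem := ⟨1, Submodule.subset_span ⟨[], by simp [degree], by simp⟩, map_one (proj F n)⟩
  mul_mem := by
    rintro i j _ _ ⟨a, ha, rfl⟩ ⟨b, hb, rfl⟩
    exact ⟨a * b, levelT_mul F n ha hb, map_mul (proj F n) a b⟩
  exhaustive a := by
    obtain ⟨b, rfl⟩ := RingQuot.mkAlgHom_surjective F (Rel F n) a
    obtain ⟨j, hj⟩ := levelT_exhaustive F n b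
    exact ⟨j, b, hj, rfl⟩

variable {n} in
theorem r_mem (A : Finset (Fin n)) : r F A ∈ (filtQ F n).level A.card := by
  refine ⟨v F A, ?_, rfl⟩
  by_cases h : A.Nonempty
  · exact Submodule.subset_span ⟨[⟨A, h⟩], by simp [degree], by simp⟩
  · simp only [v, h, dif_neg, not_false_eq_true]
    exact Submodule.zero_mem _

/-- The associated graded algebra `gr Q_n`. -/
abbrev GrQ : Type u := (filtQ F n).Gr

variable {n} in
/-- The element `r̄(A) = r(A) + Q_{n,(|A|-1)}` of `gr Q_n`. -/
def rbar (A : Finset (Fin n)) : GrQ F n := (filtQ F n).symbol A.card (r F A) (r_mem F A)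

/-- For `n ≥ 1`, the subalgebra `Q_n(1)` of `Q_n` generated by the `r(A)` with `1 ∈ A`. -/
def QOne [NeZero n] : Subalgebra F (Q F n) :=
  Algebra.adjoin F {x | ∃ A : Finset (Fin n), 0 ∈ A ∧ x = r F A}

/-- The filtration of `Q_n(1)` induced by that of `Q_n`. -/
def filtQOne [NeZero n] : AlgFiltration F (QOne F n) := (filtQ F n).induced (QOne F n)

/-- The associated graded algebra `gr Q_n(1)`. -/
abbrev GrQOne [NeZero n] : Type u := (filtQOne F n).Gr

variable {n} in
/-- The element `r̄(A)` of `gr Q_n(1)`, for a set `A` containing `1`. -/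
def rbarOne [NeZero n] (A : Finset (Fin n)) (h : 0 ∈ A) : GrQOne F n :=
  (filtQOne F n).symbol A.card ⟨r F A, Algebra.subset_adjoin ⟨A, h, rfl⟩⟩ (r_mem F A)

variable {n} in
/-- `δ(A) = {1} ∪ {a + 1 | a ∈ A}`, a subset of `{1, …, n + 1}`. -/
def delta (A : Finset (Fin n)) : Finset (Fin (n + 1)) := insert 0 (A.image Fin.succ)

variable {n} in
theorem zero_mem_delta (A : Finset (Fin n)) : 0 ∈ delta A := Finset.mem_insert_self _ _

end PseudoRoots

end

open scoped DirectSum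

noncomputable section

universe u

/-! ### Subfamilies adapted to a weight -/

/-! Put `x = r({1})`. The defining relations survive adding one constant to all the generators in
them (`rel_add_left`). Hence `r(A) ↦ r(δ(A)) - x` is a homomorphism `φ = shift` from `Q_n` to
`Q_{n+1}(1)`. Conversely, a homomorphism `f` on `Q_n` and any element `x` give a homomorphism on
`Q_{n+1}`, namely `r(A) ↦ x + f(r(A \ min A))` (`extend`).

With `f = φ` this is a retraction of `Q_{n+1}` onto `Q_{n+1}(1)`. It preserves degrees, since `A`
and `δ(A \ min A)` have equally many elements. So the induced filtration has no unexpected elements: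
its level `j` is spanned by the words `φ(m₀) x φ(m₁) x ⋯ x φ(m_k)` of weight at most `j`, where `x`
weighs `1` and each letter `r(A)` of a monomial `m` weighs `|A| + 1`, that is, `m` weighs its degree
plus its length (`extend_mem_wordLevel`). If the `m` run over a basis of `Q_n`, these words are
independent, because `Q_{n+1}` acts on a direct sum of copies of `Q_n` so that the words carry one
vector to distinct basis vectors (`linearIndependent_sepWord`).

It remains to reconcile the weight "degree plus length" with the filtration of `Q_n` by degree. The
relations are homogeneous of length two, so `Q_n` is graded by length, and within one length the two
weights differ by a constant. This makes `φ` induce a homomorphism on `gr Q_n`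
(`RaisesDegree.grHom`), and makes the symbols of a monomial basis adapted to degree plus length span
`gr Q_n` (`span_symbol_monomial`). The words in these symbols with separator `X` span the free
product, and the comparison map carries them to the symbols of the adapted basis of `Q_{n+1}(1)`,
which form a basis of its graded algebra. Hence it is bijective. -/

/-- Every weighted family of vectors has a linearly independent subfamily in which each member of
the family is expressed by vectors of no larger weight. -/
theorem exists_linearIndepOn_adapted {K V W : Type*} [Field K] [AddCommGroup V] [Module K V]
    (v : W → V) (wt : W → ℕ) :
    ∃ I : Set W, LinearIndepOn K v I ∧
      ∀ w, v w ∈ Submodule.span K (v '' {x | x ∈ I ∧ wt x ≤ wt w}) := by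
  -- Greedy choice by increasing weight: an independent set of vectors of weight below `j` is
  -- extended, using vectors of weight `j` or less only, until it spans all of them.
  have step : ∀ j (s : {s : Set W // LinearIndepOn K v s ∧ s ⊆ {x | wt x < j}}),
      ∃ t : {s : Set W // LinearIndepOn K v s ∧ s ⊆ {x | wt x < j + 1}},
        s.1 ⊆ t.1 ∧ v '' {x | wt x < j + 1} ⊆ Submodule.span K (v '' t.1) := by
    rintro j ⟨s, hs, hsj⟩
    obtain ⟨b, hb, hsb, hspan, hli⟩ := exists_linearIndepOn_extension hs
      (t := {x | wt x < j + 1}) fun x hx => Nat.lt_succ_of_lt (hsj hx)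
    exact ⟨⟨b, hli, hb⟩, hsb, hspan⟩
  choose next hsub hspan using step
  let S : (j : ℕ) → {s : Set W // LinearIndepOn K v s ∧ s ⊆ {x | wt x < j}} :=
    fun j => Nat.rec (motive := fun j => {s : Set W // LinearIndepOn K v s ∧ s ⊆ {x | wt x < j}})
      ⟨∅, linearIndepOn_empty K v, Set.empty_subset _⟩ next j
  have hmono : Monotone fun j => (S j).1 := monotone_nat_of_le_succ fun j => hsub j (S j)
  refine ⟨⋃ j, (S j).1, ?_, fun w => ?_⟩
  · exact linearIndepOn_iUnion_of_directed hmono.directed_le fun j => (S j).2.1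
  · have h : v w ∈ Submodule.span K (v '' (S (wt w + 1)).1) :=
      hspan (wt w) (S (wt w)) (Set.mem_image_of_mem v (Nat.lt_succ_self (wt w)))
    have hS : (S (wt w + 1)).1 ⊆ {x | x ∈ ⋃ j, (S j).1 ∧ wt x ≤ wt w} := fun x hx =>
      ⟨Set.mem_iUnion.2 ⟨wt w + 1, hx⟩, Nat.lt_succ_iff.1 ((S (wt w + 1)).2.2 hx)⟩
    exact Submodule.span_mono (Set.image_mono hS) h

/-! ### Symbols -/

namespace AlgFiltration

variable {F : Type u} [Field F] {A : Type u} [Ring A] [Algebra F A] (N : AlgFiltration F A)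

/-- The symbol map on a level, as a linear map. -/
def symbolLinear (j : ℕ) : N.level j →ₗ[F] N.Gr :=
  DirectSum.lof F ℕ N.Piece j ∘ₗ Submodule.mkQ ((N.below j).submoduleOf (N.level j))

theorem cls_eq_zero {j : ℕ} {a : A} (h : a ∈ N.level j) (hb : a ∈ N.below j) :
    N.cls j a h = 0 :=
  (Submodule.Quotient.mk_eq_zero ((N.below j).submoduleOf (N.level j))).2 hb

theorem symbol_eq_zero {j : ℕ} {a : A} (h : a ∈ N.level j) (hb : a ∈ N.below j) :
    N.symbol j a h = 0 := by
  rw [symbol, N.cls_eq_zero h hb, map_zero]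

theorem mem_below_of_lt {i j : ℕ} (hij : i < j) {a : A} (ha : a ∈ N.level i) : a ∈ N.below j := by
  cases j with
  | zero => omega
  | succ j => exact N.mono (Nat.lt_succ_iff.1 hij) ha

theorem symbol_mul {i j : ℕ} {a b : A} (ha : a ∈ N.level i) (hb : b ∈ N.level j) :
    N.symbol i a ha * N.symbol j b hb = N.symbol (i + j) (a * b) (N.mul_mem ha hb) :=
  DirectSum.of_mul_of _ _

theorem symbol_congr {i j : ℕ} {a b : A} (ha : a ∈ N.level i) (hb : b ∈ N.level j) (hij : i = j)
    (hab : a = b) : N.symbol i a ha = N.symbol j b hb := by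
  subst hij hab
  rfl

theorem symbol_add {j : ℕ} {a b : A} (ha : a ∈ N.level j) (hb : b ∈ N.level j) :
    N.symbol j (a + b) (Submodule.add_mem _ ha hb) = N.symbol j a ha + N.symbol j b hb :=
  map_add (N.symbolLinear j) ⟨a, ha⟩ ⟨b, hb⟩

theorem symbol_smul {j : ℕ} (c : F) {a : A} (ha : a ∈ N.level j) :
    N.symbol j (c • a) (Submodule.smul_mem _ c ha) = c • N.symbol j a ha :=
  map_smul (N.symbolLinear j) c ⟨a, ha⟩

theorem symbol_zero (j : ℕ) : N.symbol j 0 (Submodule.zero_mem _) = 0 :=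
  map_zero (N.symbolLinear j)

theorem symbol_eq_of_sub_mem {j : ℕ} {a b : A} (ha : a ∈ N.level j) (hb : b ∈ N.level j)
    (h : a - b ∈ N.below j) : N.symbol j a ha = N.symbol j b hb := by
  have h0 := N.symbol_eq_zero (Submodule.sub_mem _ ha hb) h
  rw [← zero_add (N.symbol j b hb), ← h0, ← N.symbol_add _ hb]
  exact N.symbol_congr _ _ rfl (sub_add_cancel a b).symm

theorem symbol_mem_of_mem_span {j : ℕ} {s : Set A} {P : Submodule F N.Gr}
    (hs : ∀ a ∈ s, ∃ h : a ∈ N.level j, N.symbol j a h ∈ P) {a : A}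
    (ha : a ∈ Submodule.span F s) : ∃ h : a ∈ N.level j, N.symbol j a h ∈ P := by
  induction ha using Submodule.span_induction with
  | mem a ha => exact hs a ha
  | zero => exact ⟨Submodule.zero_mem _, by rw [N.symbol_zero]; exact P.zero_mem⟩
  | add a b _ _ ha hb =>
    obtain ⟨ha, ha'⟩ := ha
    obtain ⟨hb, hb'⟩ := hb
    exact ⟨Submodule.add_mem _ ha hb, by rw [N.symbol_add ha hb]; exact P.add_mem ha' hb'⟩
  | smul c a _ ha =>
    obtain ⟨ha, ha'⟩ := ha
    exact ⟨Submodule.smul_mem _ c ha, by rw [N.symbol_smul c ha]; exact P.smul_mem c ha'⟩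

/-- A subspace of the associated graded algebra containing the symbols of vectors that span the
levels is everything. -/
theorem eq_top_of_symbol_mem {s : ℕ → Set A} (hN : ∀ j, N.level j ≤ Submodule.span F (s j))
    {P : Submodule F N.Gr} (hs : ∀ j, ∀ a ∈ s j, ∃ h : a ∈ N.level j, N.symbol j a h ∈ P) :
    P = ⊤ := by
  refine eq_top_iff.2 fun x _ => ?_
  induction x using DirectSum.induction_on with
  | zero => exact P.zero_mem
  | of j x =>
    obtain ⟨a, ha, rfl⟩ := N.cls_surj x
    exact (N.symbol_mem_of_mem_span (hs j) (hN j ha)).2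
  | add x y hx hy => exact P.add_mem (hx trivial) (hy trivial)

/-- The map of a homogeneous component induced by a linear map on `A`. -/
def pieceLift {M : Type*} [AddCommGroup M] [Module F M] {j : ℕ} (g : A →ₗ[F] M)
    (hg : ∀ a ∈ N.below j, g a = 0) : N.Piece j →ₗ[F] M :=
  Submodule.liftQ ((N.below j).submoduleOf (N.level j)) (g.domRestrict (N.level j))
    fun a ha => hg a.1 ha

/-- A homomorphism out of the associated graded algebra, given by linear maps of the homogeneous
components that are compatible with products. -/
def grLift {R : Type*} [Semiring R] [Algebra F R] (g : ∀ j, N.Piece j →ₗ[F] R)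
    (h1 : g 0 (N.cls 0 1 N.one_mem) = 1)
    (hmul : ∀ i j a b (ha : a ∈ N.level i) (hb : b ∈ N.level j),
      g (i + j) (N.cls (i + j) (a * b) (N.mul_mem ha hb)) = g i (N.cls i a ha) * g j (N.cls j b hb)) :
    N.Gr →ₐ[F] R :=
  DirectSum.toAlgebra F N.Piece g h1
    (by
      intro i j x y
      obtain ⟨a, ha, rfl⟩ := N.cls_surj x
      obtain ⟨b, hb, rfl⟩ := N.cls_surj y
      exact hmul i j a b ha hb)

theorem grLift_symbol {R : Type*} [Semiring R] [Algebra F R] (g : ∀ j, N.Piece j →ₗ[F] R) (h1 hmul)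
    {j : ℕ} {a : A} (ha : a ∈ N.level j) :
    N.grLift g h1 hmul (N.symbol j a ha) = g j (N.cls j a ha) :=
  DirectSum.toAddMonoid_of (fun j => (g j).toAddMonoidHom) j (N.cls j a ha)

/-! ### Bases adapted to a filtration -/

section Adapted

variable {K : Type*} {e : K → A} {wt : K → ℕ}

theorem mem_level_of_adapted (hN : ∀ j, N.level j = Submodule.span F (e '' {k | wt k ≤ j}))
    (k : K) : e k ∈ N.level (wt k) := by
  rw [hN]
  exact Submodule.subset_span ⟨k, le_refl (wt k), rfl⟩

theorem below_eq_of_adapted (hN : ∀ j, N.level j = Submodule.span F (e '' {k | wt k ≤ j}))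
    (j : ℕ) : N.below j = Submodule.span F (e '' {k | wt k < j}) := by
  cases j with
  | zero => simp [below]
  | succ j => simp only [below, hN, Nat.lt_succ_iff]

/-- In degree `j` only the basis vectors of weight exactly `j` contribute; those of smaller weight
have zero symbol there. -/
theorem span_symbol_of_adapted
    (hN : ∀ j, N.level j = Submodule.span F (e '' {k | wt k ≤ j})) :
    Submodule.span F (Set.range fun k =>
      N.symbol (wt k) (e k) (N.mem_level_of_adapted hN k)) = ⊤ := by
  refine N.eq_top_of_symbol_mem (fun j => (hN j).le) ?_
  rintro j _ ⟨k, hk, rfl⟩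
  have hk : wt k ≤ j := hk
  refine ⟨N.mono hk (N.mem_level_of_adapted hN k), ?_⟩
  rcases hk.eq_or_lt with rfl | hlt
  · exact Submodule.subset_span ⟨k, rfl⟩
  · rw [N.symbol_eq_zero _ (N.mem_below_of_lt hlt (N.mem_level_of_adapted hN k))]
    exact Submodule.zero_mem _

/-- The symbols of a basis adapted to the filtration are linearly independent. -/
theorem linearIndependent_symbol_of_adapted (he : LinearIndependent F e)
    (hN : ∀ j, N.level j = Submodule.span F (e '' {k | wt k ≤ j})) :
    LinearIndependent F fun k => N.symbol (wt k) (e k) (N.mem_level_of_adapted hN k) := by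
  classical
  have htop : ⊤ ≤ Submodule.span F (Set.range e) := fun a _ => by
    obtain ⟨j, hj⟩ := N.exhaustive a
    rw [hN] at hj
    exact Submodule.span_mono (Set.image_subset_range _ _) hj
  let b := Module.Basis.mk he htop
  -- `c j` keeps the coordinates of weight exactly `j`. It kills what lies below level `j`, so the
  -- maps `c j` descend to a coordinate map on the graded algebra.
  let c : ℕ → A →ₗ[F] K →₀ F := fun j =>
    b.constr F fun k => if wt k = j then Finsupp.single k 1 else 0
  have hc : ∀ j k, c j (e k) = if wt k = j then Finsupp.single k 1 else 0 := fun j k => by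
    have := b.constr_basis F (fun k => if wt k = j then Finsupp.single k (1 : F) else 0) k
    rwa [Module.Basis.mk_apply] at this
  have hker : ∀ j, ∀ a ∈ N.below j, c j a = 0 := by
    intro j a ha
    rw [N.below_eq_of_adapted hN] at ha
    have hle : Submodule.span F (e '' {k | wt k < j}) ≤ LinearMap.ker (c j) := by
      rw [Submodule.span_le]
      rintro _ ⟨k, hk, rfl⟩
      exact (hc j k).trans (if_neg (ne_of_lt hk))
    exact hle ha
  let C : N.Gr →ₗ[F] K →₀ F := DirectSum.toModule F ℕ _ fun j => N.pieceLift (c j) (hker j)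
  refine LinearIndependent.of_comp C ?_
  have hC : (C ∘ fun k => N.symbol (wt k) (e k) (N.mem_level_of_adapted hN k)) =
      fun k => Finsupp.single k 1 := by
    funext k
    refine (DirectSum.toModule_lof F (wt k) _).trans ?_
    exact (hc _ k).trans (if_pos rfl)
  rw [hC]
  exact Finsupp.linearIndependent_single_one F K

end Adapted

end AlgFiltration

namespace PseudoRoots

/-! ### Homomorphisms out of `Q_n` -/

section Lift

variable (F : Type u) [Field F] {n : ℕ}

theorem r_empty : r F (∅ : Finset (Fin n)) = 0 := by
  simp [r, v]

theorem r_rel (A : Finset (Fin n)) (i j : Fin n) (hi : i ∈ A) (hj : j ∈ A) (hij : i ≠ j) :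
    r F A * (r F (A \ {i}) - r F (A \ {j})) + (r F (A \ {i}) - r F (A \ {j})) * r F (A \ {i, j})
      - r F (A \ {i}) ^ 2 + r F (A \ {j}) ^ 2 = 0 := by
  have h := RingQuot.mkAlgHom_rel F (Rel.mk (F := F) A i j hi hj hij)
  simpa [r, proj] using h

variable {B : Type*} [Ring B] [Algebra F B]

variable {F} in
/-- A homomorphism `Q_n → B` given by elements of `B` that satisfy the defining relations. -/
def lift (p : Finset (Fin n) → B) (h0 : p ∅ = 0)
    (h : ∀ (A : Finset (Fin n)) (i j : Fin n), i ∈ A → j ∈ A → i ≠ j →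
      p A * (p (A \ {i}) - p (A \ {j})) + (p (A \ {i}) - p (A \ {j})) * p (A \ {i, j})
        - p (A \ {i}) ^ 2 + p (A \ {j}) ^ 2 = 0) :
    Q F n →ₐ[F] B :=
  RingQuot.liftAlgHom F ⟨FreeAlgebra.lift F fun A : Gens n => p A.1, by
    have hv : ∀ A : Finset (Fin n), FreeAlgebra.lift F (fun A : Gens n => p A.1) (v F A) = p A := by
      intro A
      by_cases hA : A.Nonempty
      · simp [v, hA]
      · obtain rfl := Finset.not_nonempty_iff_eq_empty.1 hA
        simp [v, h0]
    rintro _ _ ⟨A, i, j, hi, hj, hij⟩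
    simpa only [map_add, map_sub, map_mul, map_pow, map_zero, hv] using h A i j hi hj hij⟩

theorem lift_r (p : Finset (Fin n) → B) (h0 h) (A : Finset (Fin n)) :
    lift (F := F) p h0 h (r F A) = p A := by
  rw [lift, r, proj, RingQuot.liftAlgHom_mkAlgHom_apply]
  by_cases hA : A.Nonempty
  · simp [v, hA]
  · obtain rfl := Finset.not_nonempty_iff_eq_empty.1 hA
    simp [v, h0]

variable {F} in
theorem hom_ext {f g : Q F n →ₐ[F] B} (h : ∀ A, f (r F A) = g (r F A)) : f = g := by
  refine RingQuot.ringQuot_ext' F _ _ (FreeAlgebra.hom_ext (funext fun A => ?_))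
  have := h A.1
  simpa [r, v, A.2, proj] using this

/-- The product `r(A₁) ⋯ r(A_l)`. -/
def monomial (w : List (Gens n)) : Q F n := (w.map fun A => r F A.1).prod

theorem monomial_append (w w' : List (Gens n)) :
    monomial F (w ++ w') = monomial F w * monomial F w' := by
  simp [monomial]

theorem level_filtQ (j : ℕ) :
    (filtQ F n).level j = Submodule.span F (monomial F '' {w | degree w ≤ j}) := by
  change (levelT F n j).map (proj F n).toLinearMap = _
  rw [levelT, Submodule.map_span]
  congr 1
  ext x
  constructor
  · rintro ⟨_, ⟨w, hw, rfl⟩, rfl⟩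
    exact ⟨w, hw, by simp [monomial, r, map_list_prod, Function.comp_def]⟩
  · rintro ⟨w, hw, rfl⟩
    exact ⟨_, ⟨w, hw, rfl⟩, by simp [monomial, r, map_list_prod, Function.comp_def]⟩

theorem monomial_mem {w : List (Gens n)} {j : ℕ} (h : degree w ≤ j) :
    monomial F w ∈ (filtQ F n).level j := by
  rw [level_filtQ]
  exact Submodule.subset_span ⟨w, h, rfl⟩

theorem degree_append (w w' : List (Gens n)) : degree (w ++ w') = degree w + degree w' := by
  simp [degree]

theorem span_monomial : Submodule.span F (Set.range (monomial F (n := n))) = ⊤ := by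
  refine eq_top_iff.2 fun a _ => ?_
  obtain ⟨j, hj⟩ := (filtQ F n).exhaustive a
  rw [level_filtQ] at hj
  exact Submodule.span_mono (Set.image_subset_range _ _) hj

end Lift

/-! ### Removing the least element -/

section DropMin

variable {n : ℕ}

/-- The set `A` without its least element, shifted down by one. -/
def dropMin (A : Finset (Fin (n + 1))) : Finset (Fin n) :=
  Finset.univ.filter fun c => c.succ ∈ A ∧ ∃ b ∈ A, b < c.succ

theorem mem_dropMin {A : Finset (Fin (n + 1))} {c : Fin n} :
    c ∈ dropMin A ↔ c.succ ∈ A ∧ ∃ b ∈ A, b < c.succ := by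
  simp [dropMin]

/-- The minimum changes with the set, but "some element is smaller" is a condition that persists in
larger sets. -/
theorem dropMin_mono {A B : Finset (Fin (n + 1))} (h : A ⊆ B) : dropMin A ⊆ dropMin B := by
  intro c hc
  rw [mem_dropMin] at hc ⊢
  obtain ⟨hc, b, hb, hbc⟩ := hc
  exact ⟨h hc, b, h hb, hbc⟩

theorem card_dropMin {A : Finset (Fin (n + 1))} (hA : A.Nonempty) :
    (dropMin A).card + 1 = A.card := by
  have h : (dropMin A).image Fin.succ = A.erase (A.min' hA) := by
    ext a
    simp only [Finset.mem_image, mem_dropMin, Finset.mem_erase]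
    constructor
    · rintro ⟨c, ⟨hc, b, hb, hbc⟩, rfl⟩
      exact ⟨((A.min'_le b hb).trans_lt hbc).ne', hc⟩
    · rintro ⟨ha, haA⟩
      have hlt : A.min' hA < a := lt_of_le_of_ne (A.min'_le a haA) (Ne.symm ha)
      obtain ⟨c, rfl⟩ := Fin.exists_succ_eq.2 (Fin.ne_zero_of_lt hlt)
      exact ⟨c, ⟨haA, _, A.min'_mem hA, hlt⟩, rfl⟩
  rw [← Finset.card_image_of_injective _ (Fin.succ_injective n), h,
    Finset.card_erase_add_one (A.min'_mem hA)]

theorem succ_mem_delta (A : Finset (Fin n)) (c : Fin n) : c.succ ∈ delta A ↔ c ∈ A := by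
  simp [delta]

theorem dropMin_delta (A : Finset (Fin n)) : dropMin (delta A) = A := by
  ext c
  rw [mem_dropMin, succ_mem_delta]
  exact ⟨fun h => h.1, fun h => ⟨h, 0, zero_mem_delta A, Fin.succ_pos c⟩⟩

/-- With `dropMin_delta`, this identifies the sets containing `0` with the subsets of `Fin n`; it is
what makes `retraction` the identity on generators of `QOne`. -/
theorem delta_dropMin {A : Finset (Fin (n + 1))} (h : 0 ∈ A) : delta (dropMin A) = A := by
  ext a
  refine Fin.cases ?_ (fun c => ?_) a
  · simp [h, zero_mem_delta]
  · rw [succ_mem_delta, mem_dropMin]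
    exact ⟨fun h => h.1, fun hc => ⟨hc, 0, h, Fin.succ_pos c⟩⟩

theorem delta_empty : delta (∅ : Finset (Fin n)) = {0} := by
  simp [delta]

theorem card_delta (A : Finset (Fin n)) : (delta A).card = A.card + 1 := by
  rw [← card_dropMin ⟨0, zero_mem_delta A⟩, dropMin_delta]

theorem delta_sdiff (A : Finset (Fin n)) (S : Finset (Fin n)) :
    delta (A \ S) = delta A \ S.image Fin.succ := by
  ext a
  refine Fin.cases ?_ (fun c => ?_) a
  · simp [zero_mem_delta, Fin.succ_ne_zero]
  · simp [succ_mem_delta]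

theorem exists_eq_sdiff_singleton {α : Type*} [DecidableEq α] {S T : Finset α} (h : T ⊆ S)
    (hc : T.card + 1 = S.card) : ∃ a ∈ S, T = S \ {a} := by
  have h1 : (S \ T).card = 1 := by
    rw [Finset.card_sdiff_of_subset h]
    omega
  obtain ⟨a, ha⟩ := Finset.card_eq_one.1 h1
  have haS : a ∈ S \ T := by simp [ha]
  exact ⟨a, (Finset.mem_sdiff.1 haS).1, by rw [← ha, Finset.sdiff_sdiff_eq_self h]⟩

/-- `dropMin` maps a square `A ⊃ A \ i, A \ j ⊃ A \ {i, j}` to a degenerate square or to a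
square of the same shape. -/
theorem dropMin_square {A : Finset (Fin (n + 1))} {i j : Fin (n + 1)} (hi : i ∈ A) (hj : j ∈ A)
    (hij : i ≠ j) (hne : dropMin (A \ {i}) ≠ dropMin (A \ {j})) :
    (A \ {i, j}).Nonempty ∧ ∃ a ∈ dropMin A, ∃ b ∈ dropMin A, a ≠ b ∧
      dropMin (A \ {i}) = dropMin A \ {a} ∧ dropMin (A \ {j}) = dropMin A \ {b} ∧
      dropMin (A \ {i, j}) = dropMin A \ {a, b} := by
  have ci : (A \ {i}).card + 1 = A.card := by
    rw [Finset.sdiff_singleton_eq_erase, Finset.card_erase_add_one hi]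
  have cj : (A \ {j}).card + 1 = A.card := by
    rw [Finset.sdiff_singleton_eq_erase, Finset.card_erase_add_one hj]
  have cij : (A \ {i, j}).card + 2 = A.card := by
    have hsub : ({i, j} : Finset (Fin (n + 1))) ⊆ A := by
      simp [Finset.insert_subset_iff, hi, hj]
    have := Finset.card_le_card hsub
    rw [Finset.card_sdiff_of_subset hsub]
    rw [Finset.card_pair hij] at this ⊢
    omega
  have ni : (A \ {i}).Nonempty := ⟨j, by simp [hj, hij.symm]⟩
  have nj : (A \ {j}).Nonempty := ⟨i, by simp [hi, hij]⟩
  have di := card_dropMin ni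
  have dj := card_dropMin nj
  have dA := card_dropMin ⟨i, hi⟩
  -- If `A = {i, j}`, both smaller sets are singletons and become empty, which is the degenerate
  -- case.
  have nij : (A \ {i, j}).Nonempty := by
    rw [Finset.nonempty_iff_ne_empty]
    intro h
    rw [h, Finset.card_empty] at cij
    refine hne ?_
    rw [Finset.card_eq_zero.1 (show (dropMin (A \ {i})).card = 0 by omega),
      Finset.card_eq_zero.1 (show (dropMin (A \ {j})).card = 0 by omega)]
  have dij := card_dropMin nij
  obtain ⟨a, ha, hia⟩ := exists_eq_sdiff_singleton (dropMin_mono (Finset.sdiff_subset (t := {i})))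
    (show _ = (dropMin A).card by omega)
  obtain ⟨b, hb, hjb⟩ := exists_eq_sdiff_singleton (dropMin_mono (Finset.sdiff_subset (t := {j})))
    (show _ = (dropMin A).card by omega)
  have hab : a ≠ b := by
    rintro rfl
    exact hne (hia.trans hjb.symm)
  refine ⟨nij, a, ha, b, hb, hab, hia, hjb, Finset.eq_of_subset_of_card_le ?_ ?_⟩
  · have h1 : dropMin (A \ {i, j}) ⊆ dropMin A \ {a} :=
      hia ▸ dropMin_mono (Finset.sdiff_subset_sdiff subset_rfl (by simp))
    have h2 : dropMin (A \ {i, j}) ⊆ dropMin A \ {b} :=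
      hjb ▸ dropMin_mono (Finset.sdiff_subset_sdiff subset_rfl (by simp))
    intro c hc
    have h1 := h1 hc
    have h2 := h2 hc
    simp only [Finset.mem_sdiff, Finset.mem_singleton, Finset.mem_insert] at h1 h2 ⊢
    tauto
  · rw [Finset.card_sdiff_of_subset (by simp [Finset.insert_subset_iff, ha, hb]),
      Finset.card_pair hab]
    omega

end DropMin

/-! ### The homomorphisms relating `Q_n` and `Q_{n+1}` -/

section Homs

variable {F : Type u} [Field F] {n : ℕ} {B : Type*} [Ring B] [Algebra F B]

/-- The defining relations are invariant under a common translation of the generators. -/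
theorem rel_add_left {R : Type*} [Ring R] (x a b c d : R) :
    a * (b - c) + (b - c) * d - b ^ 2 + c ^ 2 =
      (x + a) * (x + b - (x + c)) + (x + b - (x + c)) * (x + d) - (x + b) ^ 2 + (x + c) ^ 2 := by
  noncomm_ring

/-- The homomorphism `Q_n → B` with `r(A) ↦ p(A) - p(∅)`, for elements `p(A)` of `B` that satisfy
the defining relations. -/
def liftSub (p : Finset (Fin n) → B)
    (h : ∀ (A : Finset (Fin n)) (i j : Fin n), i ∈ A → j ∈ A → i ≠ j →
      p A * (p (A \ {i}) - p (A \ {j})) + (p (A \ {i}) - p (A \ {j})) * p (A \ {i, j})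
        - p (A \ {i}) ^ 2 + p (A \ {j}) ^ 2 = 0) :
    Q F n →ₐ[F] B :=
  lift (fun A => -p ∅ + p A) (neg_add_cancel _) fun A i j hi hj hij =>
    (rel_add_left _ _ _ _ _).symm.trans (h A i j hi hj hij)

theorem liftSub_r (p : Finset (Fin n) → B) (h) (A : Finset (Fin n)) :
    liftSub (F := F) p h (r F A) = p A - p ∅ := by
  rw [liftSub, lift_r, sub_eq_neg_add]

/-- The homomorphism `Q_{n+1} → B` determined by a homomorphism `f : Q_n → B` and an element `x`:
it sends `r(A)` to `x + f(r(A \ min A))`. -/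
def extend (f : Q F n →ₐ[F] B) (x : B) : Q F (n + 1) →ₐ[F] B :=
  lift (fun A => if A.Nonempty then x + f (r F (dropMin A)) else 0) (by simp) <| by
    intro A i j hi hj hij
    have nA : A.Nonempty := ⟨i, hi⟩
    have ni : (A \ {i}).Nonempty := ⟨j, by simp [hj, hij.symm]⟩
    have nj : (A \ {j}).Nonempty := ⟨i, by simp [hi, hij]⟩
    simp only [nA, ni, nj, if_true]
    -- In a degenerate square both differences vanish and the two squares cancel. Otherwise the
    -- relation is a translate by `x` of a relation of `Q_n`.
    by_cases h : dropMin (A \ {i}) = dropMin (A \ {j})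
    · rw [h]
      simp
    obtain ⟨nij, a, ha, b, hb, hab, hia, hjb, h2⟩ := dropMin_square hi hj hij h
    have hr := congrArg f (r_rel F (dropMin A) a b ha hb hab)
    simp only [map_add, map_sub, map_mul, map_pow, map_zero] at hr
    simp only [nij, if_true, hia, hjb, h2]
    rw [← rel_add_left]
    exact hr

theorem extend_r (f : Q F n →ₐ[F] B) (x : B) {A : Finset (Fin (n + 1))} (hA : A.Nonempty) :
    extend f x (r F A) = x + f (r F (dropMin A)) := by
  rw [extend, lift_r, if_pos hA]

variable (F) in
/-- The generator `r(δ(A))` of `Q_{n+1}(1)`. -/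
def rOne (A : Finset (Fin n)) : QOne F (n + 1) :=
  ⟨r F (delta A), Algebra.subset_adjoin ⟨delta A, zero_mem_delta A, rfl⟩⟩

/-- Removing elements commutes with `delta`, so these are the relations of `Q_{n+1}` for `delta A`
at the shifted indices. Here `rOne F ∅` is not zero, which is why `shift` subtracts it. -/
theorem rOne_rel (A : Finset (Fin n)) (i j : Fin n) (hi : i ∈ A) (hj : j ∈ A) (hij : i ≠ j) :
    rOne F A * (rOne F (A \ {i}) - rOne F (A \ {j}))
      + (rOne F (A \ {i}) - rOne F (A \ {j})) * rOne F (A \ {i, j})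
      - rOne F (A \ {i}) ^ 2 + rOne F (A \ {j}) ^ 2 = 0 := by
  have h := r_rel F (delta A) i.succ j.succ ((succ_mem_delta _ _).2 hi)
    ((succ_mem_delta _ _).2 hj) (fun h => hij (Fin.succ_injective n h))
  have h1 : ∀ k : Fin n, delta A \ {k.succ} = delta (A \ {k}) := fun k => by
    simp [delta_sdiff]
  have h2 : delta A \ {i.succ, j.succ} = delta (A \ {i, j}) := by
    simp [delta_sdiff]
  rw [h1, h1, h2] at h
  exact Subtype.ext h

variable (F n) in
/-- The homomorphism `Q_n → Q_{n+1}(1)` sending `r(A)` to `r(δ(A)) - r({1})`. -/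
def shift : Q F n →ₐ[F] QOne F (n + 1) := liftSub (rOne F) rOne_rel

theorem shift_r (A : Finset (Fin n)) : shift F n (r F A) = rOne F A - rOne F ∅ :=
  liftSub_r _ _ A

theorem extend_r_delta (f : Q F n →ₐ[F] B) (x : B) (A : Finset (Fin n)) :
    extend f x (r F (delta A)) = x + f (r F A) := by
  rw [extend_r _ _ ⟨0, zero_mem_delta A⟩, dropMin_delta]

theorem extend_rOne_empty (f : Q F n →ₐ[F] B) (x : B) :
    extend f x (rOne F (∅ : Finset (Fin n))) = x := by
  refine (extend_r_delta f x ∅).trans ?_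
  rw [r_empty, map_zero, add_zero]

/-- On generators the two copies of `x` cancel: `(x + f(r(A))) - x = f(r(A))`. -/
theorem extend_shift (f : Q F n →ₐ[F] B) (x : B) (a : Q F n) :
    extend f x (shift F n a) = f a := by
  have h : ((extend f x).comp (QOne F (n + 1)).val).comp (shift F n) = f := by
    refine hom_ext fun A => ?_
    change extend f x (shift F n (r F A)) = f (r F A)
    have h1 : (shift F n (r F A) : Q F (n + 1)) = r F (delta A) - r F (delta ∅) :=
      congrArg Subtype.val (shift_r A)
    rw [h1, map_sub, extend_r_delta, extend_r_delta, r_empty, map_zero, add_zero,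
      add_sub_cancel_left]
  exact DFunLike.congr_fun h a

variable (F n) in
/-- The retraction `Q_{n+1} → Q_{n+1}(1)`. -/
def retraction : Q F (n + 1) →ₐ[F] QOne F (n + 1) := extend (shift F n) (rOne F ∅)

theorem retraction_r {A : Finset (Fin (n + 1))} (hA : A.Nonempty) :
    retraction F n (r F A) = rOne F (dropMin A) := by
  rw [retraction, extend_r _ _ hA, shift_r]
  abel

/-- This controls the induced filtration: an element of `QOne` that is a combination of arbitrary
products in `Q_{n+1}` is its own image under `retraction`, hence the same combination of products of
generators of `QOne`, with unchanged degrees. -/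
theorem retraction_coe (s : QOne F (n + 1)) : retraction F n s = s := by
  have h : ((retraction F n).comp (QOne F (n + 1)).val) = AlgHom.id F _ := by
    refine AlgHom.adjoin_ext ?_
    rintro _ ⟨A, hA, rfl⟩
    exact (retraction_r ⟨0, hA⟩).trans (Subtype.ext (congrArg (r F) (delta_dropMin hA)))
  exact DFunLike.congr_fun h s

end Homs

end PseudoRoots

/-! ### Words with separators -/

section SepWord

variable {ι R : Type*}

/-- The product `β(i) x β(i₁) x ⋯ x β(i_k)` attached to `k = (i, [i₁, …, i_k])`. -/
def sepWord [Monoid R] (β : ι → R) (x : R) (k : ι × List ι) : R :=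
  β k.1 * (k.2.map fun i => x * β i).prod

/-- The weight of a word with separators, the separators having weight `1`. -/
def sepWeight (d : ι → ℕ) (k : ι × List ι) : ℕ :=
  d k.1 + (k.2.map fun i => 1 + d i).sum

theorem map_sepWord {R' G : Type*} [Monoid R] [Monoid R'] [FunLike G R R'] [MonoidHomClass G R R']
    (f : G) (β : ι → R) (x : R) (k : ι × List ι) :
    f (sepWord β x k) = sepWord (fun i => f (β i)) (f x) k := by
  simp [sepWord, map_list_prod, Function.comp_def]

namespace AlgFiltration

variable {F : Type u} [Field F] {A : Type u} [Ring A] [Algebra F A] (N : AlgFiltration F A)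

theorem sepWord_mem {β : ι → A} {x : A} {d : ι → ℕ} (hβ : ∀ i, β i ∈ N.level (d i))
    (hx : x ∈ N.level 1) (k : ι × List ι) : sepWord β x k ∈ N.level (sepWeight d k) := by
  obtain ⟨i, L⟩ := k
  refine N.mul_mem (hβ i) ?_
  induction L with
  | nil => exact N.one_mem
  | cons i L ih =>
    simp only [List.map_cons, List.prod_cons, List.sum_cons]
    exact N.mul_mem (N.mul_mem hx (hβ i)) ih

theorem sepWord_symbol {β : ι → A} {x : A} {d : ι → ℕ} (hβ : ∀ i, β i ∈ N.level (d i))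
    (hx : x ∈ N.level 1) (k : ι × List ι) :
    sepWord (fun i => N.symbol (d i) (β i) (hβ i)) (N.symbol 1 x hx) k =
      N.symbol (sepWeight d k) (sepWord β x k) (N.sepWord_mem hβ hx k) := by
  have key : ∀ L : List ι, ∃ h : (L.map fun i => x * β i).prod ∈
      N.level (L.map fun i => 1 + d i).sum,
      (L.map fun i => N.symbol 1 x hx * N.symbol (d i) (β i) (hβ i)).prod = N.symbol _ _ h := by
    intro L
    induction L with
    | nil => exact ⟨N.one_mem, rfl⟩
    | cons i L ih =>
      obtain ⟨h, ih⟩ := ih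
      refine ⟨N.mul_mem (N.mul_mem hx (hβ i)) h, ?_⟩
      rw [List.map_cons, List.prod_cons, ih, N.symbol_mul, N.symbol_mul]
      rfl
  obtain ⟨i, L⟩ := k
  obtain ⟨h, hL⟩ := key L
  rw [sepWord, hL, N.symbol_mul]
  rfl

end AlgFiltration

/-- A subspace containing all `f(q) x f(b(i₁)) x ⋯ x f(b(i_k))` as soon as it contains those
with `q` in a spanning set. -/
theorem map_mul_prod_mem {F Q : Type*} [CommSemiring F] [Semiring Q] [Algebra F Q] [Semiring R]
    [Algebra F R] (f : Q →ₐ[F] R) (t : R) {s : Set Q} {P : Submodule F R}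
    (h : ∀ q ∈ s, f q * t ∈ P) {q : Q} (hq : q ∈ Submodule.span F s) : f q * t ∈ P := by
  have hle : Submodule.span F s ≤ P.comap (LinearMap.mulRight F t ∘ₗ f.toLinearMap) :=
    Submodule.span_le.2 h
  exact hle hq

end SepWord

/-! ### The free product -/

namespace FreeProd

variable {F : Type u} [Field F] {A B : Type u} [Semiring A] [Algebra F A] [Semiring B] [Algebra F B]
  {R : Type*} [Semiring R] [Algebra F R]

/-- The members of a two-member family of homomorphisms. -/
def homs (f : A →ₐ[F] R) (g : B →ₐ[F] R) : (i : Bool) → BinaryFreeProduct.Fam A B i →ₐ[F] R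
  | false => f
  | true => g

/-- The universal property of the free product. -/
def lift (f : A →ₐ[F] R) (g : B →ₐ[F] R) : FreeProd F A B →ₐ[F] R :=
  LinearAlgebra.FreeProduct.lift F (BinaryFreeProduct.Fam A B) fun {i} => homs f g i

theorem lift_comp_ι (f : A →ₐ[F] R) (g : B →ₐ[F] R) (i : Bool) :
    (lift f g).comp (LinearAlgebra.FreeProduct.ι F (BinaryFreeProduct.Fam A B) i) = homs f g i := 
  congrFun (congrArg (fun (m : {i : Bool} → BinaryFreeProduct.Fam A B i →ₐ[F] R) i => @m i)
    ((LinearAlgebra.FreeProduct.lift F (BinaryFreeProduct.Fam A B)).symm_apply_apply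
      fun {i} => homs f g i)) i

theorem lift_inl (f : A →ₐ[F] R) (g : B →ₐ[F] R) (a : A) : lift f g (inl F A B a) = f a :=
  DFunLike.congr_fun (lift_comp_ι f g false) a

theorem lift_inr (f : A →ₐ[F] R) (g : B →ₐ[F] R) (b : B) : lift f g (inr F A B b) = g b :=
  DFunLike.congr_fun (lift_comp_ι f g true) b

theorem hom_ext {f g : FreeProd F A B →ₐ[F] R} (hl : ∀ a, f (inl F A B a) = g (inl F A B a))
    (hr : ∀ b, f (inr F A B b) = g (inr F A B b)) : f = g := by
  apply (LinearAlgebra.FreeProduct.lift F (BinaryFreeProduct.Fam A B)).symm.injective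
  funext i
  cases i
  · exact AlgHom.ext hl
  · exact AlgHom.ext hr

/-- The universal property gives a homomorphism into `T` whose composite with the inclusion is the
identity, so every element lies in `T`. -/
theorem eq_top_of_mem {T : Subalgebra F (FreeProd F A B)} (hl : ∀ a, inl F A B a ∈ T)
    (hr : ∀ b, inr F A B b ∈ T) : T = ⊤ := by
  have h : T.val.comp (lift ((inl F A B).codRestrict T hl) ((inr F A B).codRestrict T hr)) =
      AlgHom.id F _ :=
    hom_ext (fun a => by rw [AlgHom.comp_apply, lift_inl]; rfl)
      (fun b => by rw [AlgHom.comp_apply, lift_inr]; rfl)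
  refine Algebra.eq_top_iff.2 fun a => ?_
  rw [← AlgHom.id_apply (R := F) a, ← h]
  exact Subtype.prop _

/-- If the `b(i)` span `A`, the words in the `b(i)` with separator `X` span `A * F[X]`. -/
theorem span_sepWord {ι : Type*} {b : ι → A} (hb : Submodule.span F (Set.range b) = ⊤) :
    Submodule.span F (Set.range (sepWord (fun i => inl F A (Polynomial F) (b i))
      (inr F A (Polynomial F) Polynomial.X))) = ⊤ := by
  set P := Submodule.span F (Set.range (sepWord (fun i => inl F A (Polynomial F) (b i))
      (inr F A (Polynomial F) Polynomial.X))) with hP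
  -- The first block is an arbitrary element of `A`. This matters because `1` need not be one of the
  -- `b i`.
  have hmem : ∀ (a : A) (L : List ι), inl F A (Polynomial F) a *
      (L.map fun i => inr F A (Polynomial F) Polynomial.X * inl F A (Polynomial F) (b i)).prod
        ∈ P := by
    intro a L
    refine map_mul_prod_mem _ _ (s := Set.range b) ?_ (hb ▸ Submodule.mem_top)
    rintro _ ⟨i, rfl⟩
    exact Submodule.subset_span ⟨(i, L), rfl⟩
  -- `T` consists of the left multipliers of `P`. It contains both factors, hence everything; as `1
  -- ∈ P`, so does `P`.
  let T : Subalgebra F (FreeProd F A (Polynomial F)) :=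
    { carrier := {a | ∀ p ∈ P, a * p ∈ P}
      mul_mem' := fun {a b} ha hb p hp => by rw [mul_assoc]; exact ha _ (hb _ hp)
      add_mem' := fun {a b} ha hb p hp => by rw [add_mul]; exact P.add_mem (ha _ hp) (hb _ hp)
      algebraMap_mem' := fun c p hp => by rw [← Algebra.smul_def]; exact P.smul_mem c hp }
  have hT : ∀ a, (∀ k, a * sepWord (fun i => inl F A (Polynomial F) (b i))
      (inr F A (Polynomial F) Polynomial.X) k ∈ P) → a ∈ T := by
    intro a ha p hp
    have hle : P ≤ P.comap (LinearMap.mulLeft F a) := by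
      conv_lhs => rw [hP]
      rw [Submodule.span_le]
      rintro _ ⟨k, rfl⟩
      exact ha k
    exact hle hp
  have htop : T = ⊤ := by
    refine eq_top_of_mem (fun a => hT _ ?_) fun p => ?_
    · rintro ⟨i, L⟩
      rw [sepWord, ← mul_assoc, ← map_mul]
      exact hmem _ _
    · have hX : Polynomial.X ∈ T.comap (inr F A (Polynomial F)) := by
        refine hT _ ?_
        rintro ⟨i, L⟩
        -- Multiplying by `X` opens a new first block equal to `1`.
        have := hmem 1 (i :: L)
        rwa [map_one, one_mul, List.map_cons, List.prod_cons, mul_assoc] at this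
      have hle : Algebra.adjoin F {Polynomial.X} ≤ T.comap (inr F A (Polynomial F)) :=
        Algebra.adjoin_le (Set.singleton_subset_iff.2 hX)
      rw [Polynomial.adjoin_X] at hle
      exact hle trivial
  refine eq_top_iff.2 fun a _ => ?_
  have ha : a ∈ T := htop ▸ trivial
  have h1 := hmem 1 []
  rw [map_one, one_mul, List.map_nil, List.prod_nil] at h1
  simpa using ha 1 h1

end FreeProd

namespace PseudoRoots

variable (F : Type u) [Field F] (n : ℕ)

/-! ### The grading by length and the choice of a basis -/

variable {F n} in
/-- The defining relations are homogeneous of length two. -/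
theorem rel_monomial {R : Type*} [Ring R] (a b c d : R) :
    Polynomial.monomial 1 a * (Polynomial.monomial 1 b - Polynomial.monomial 1 c) +
        (Polynomial.monomial 1 b - Polynomial.monomial 1 c) * Polynomial.monomial 1 d -
        Polynomial.monomial 1 b ^ 2 + Polynomial.monomial 1 c ^ 2 =
      Polynomial.monomial (1 + 1) (a * (b - c) + (b - c) * d - b ^ 2 + c ^ 2) := by
  simp only [pow_two, mul_sub, sub_mul, map_sub, map_add, Polynomial.monomial_mul_monomial]

/-- The homomorphism `Q_n → Q_n[T]` with `r(A) ↦ r(A) T`, which records the length grading. -/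
def lengthHom : Q F n →ₐ[F] Polynomial (Q F n) :=
  lift (fun A => Polynomial.monomial 1 (r F A)) (by rw [r_empty, map_zero])
    fun A i j hi hj hij => (rel_monomial _ _ _ _).trans <| by
      rw [r_rel F A i j hi hj hij, map_zero]

variable {n}

theorem lengthHom_monomial (w : List (Gens n)) :
    lengthHom F n (monomial F w) = Polynomial.monomial w.length (monomial F w) := by
  induction w with
  | nil => simp [monomial]
  | cons A w ih =>
    have h : monomial F (A :: w) = r F A.1 * monomial F w := rfl
    rw [h, map_mul, ih, lengthHom, lift_r, Polynomial.monomial_mul_monomial, List.length_cons,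
      add_comm]

/-- The projection of `Q_n` to its component of length `l`. -/
def lengthProj (l : ℕ) : Q F n →ₗ[F] Q F n where
  toFun a := (lengthHom F n a).coeff l
  map_add' a b := by simp
  map_smul' c a := by simp

theorem lengthProj_monomial (l : ℕ) (w : List (Gens n)) :
    lengthProj F l (monomial F w) = if w.length = l then monomial F w else 0 := by
  change (lengthHom F n (monomial F w)).coeff l = _
  rw [lengthHom_monomial, Polynomial.coeff_monomial]

variable {F} in
/-- A relation between words of various lengths restricts to each length. -/
theorem monomial_mem_span_length {w : List (Gens n)} {J : Set (List (Gens n))}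
    (h : monomial F w ∈ Submodule.span F (monomial F '' J)) :
    monomial F w ∈ Submodule.span F (monomial F '' {w' | w' ∈ J ∧ w'.length = w.length}) := by
  -- Projecting to length `w.length` fixes the left side and deletes the words of other lengths.
  have h1 := Submodule.mem_map_of_mem (f := lengthProj F w.length) h
  rw [lengthProj_monomial, if_pos rfl, Submodule.map_span] at h1
  refine Submodule.span_le.2 ?_ h1
  rintro _ ⟨_, ⟨w', hw', rfl⟩, rfl⟩
  rw [lengthProj_monomial]
  split_ifs with hl
  · exact Submodule.subset_span ⟨w', ⟨hw', hl⟩, rfl⟩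
  · exact Submodule.zero_mem _

/-- The weight `(|A₁| + 1) + ⋯ + (|A_l| + 1)` of a string of nonempty sets. -/
def shiftedDegree (w : List (Gens n)) : ℕ := degree w + w.length

variable (n) in
/-- There is a basis of `Q_n` consisting of products of generators and adapted to the weight
`shiftedDegree`. -/
theorem exists_adapted_basis : ∃ (I : Set (List (Gens n))) (b : Module.Basis I F (Q F n)),
    (∀ i, b i = monomial F i.1) ∧ ∀ w, monomial F w ∈
      Submodule.span F (monomial F '' {x | x ∈ I ∧ shiftedDegree x ≤ shiftedDegree w}) := by
  obtain ⟨I, hI, hspan⟩ := exists_linearIndepOn_adapted (K := F) (monomial F (n := n)) shiftedDegree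
  have htop : ⊤ ≤ Submodule.span F (Set.range fun i : I => monomial F i.1) := by
    rw [← span_monomial F, Submodule.span_le]
    rintro _ ⟨w, rfl⟩
    refine Submodule.span_mono ?_ (hspan w)
    rintro _ ⟨x, hx, rfl⟩
    exact ⟨⟨x, hx.1⟩, rfl⟩
  exact ⟨I, Module.Basis.mk hI htop, fun i => Module.Basis.mk_apply _ _ _, hspan⟩

/-! ### The homomorphism of associated graded algebras -/

section GrHom

variable {F} {S : Type u} [Ring S] [Algebra F S] (N : AlgFiltration F S) (φ : Q F n →ₐ[F] S)

/-- The homomorphism `φ` raises the degree of every generator by at most one. -/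
def RaisesDegree : Prop := ∀ A : Finset (Fin n), φ (r F A) ∈ N.level (A.card + 1)

variable {N φ} (hφ : RaisesDegree N φ)
include hφ

theorem RaisesDegree.monomial_mem (w : List (Gens n)) :
    φ (monomial F w) ∈ N.level (shiftedDegree w) := by
  induction w with
  | nil =>
    have h : φ (monomial F []) = 1 := map_one _
    rw [h]
    exact N.one_mem
  | cons A w ih =>
    have h : monomial F (A :: w) = r F A.1 * monomial F w := rfl
    have hd : shiftedDegree (A :: w) = (A.1.card + 1) + shiftedDegree w := by
      simp only [shiftedDegree, degree, List.map_cons, List.sum_cons, List.length_cons]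
      omega
    rw [h, map_mul, hd]
    exact N.mul_mem (hφ A.1) ih

theorem RaisesDegree.monomial_mem_of_le {w : List (Gens n)} {j : ℕ} (h : degree w ≤ j) :
    φ (monomial F w) ∈ N.level (j + w.length) :=
  N.mono (Nat.add_le_add_right h _) (hφ.monomial_mem w)

/-- `lengthHom` splits an element into its length components, and the component of length `l` is
sent to a symbol of degree `j + l`. Using the length grading makes the map well defined on `Q_n` and
not only on words. -/
theorem RaisesDegree.exists_symbolHom (j : ℕ) : ∃ g : Q F n →ₗ[F] N.Gr,
    ∀ (w : List (Gens n)) (h : degree w ≤ j), g (monomial F w) =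
      N.symbol (j + w.length) (φ (monomial F w)) (hφ.monomial_mem_of_le h) := by
  -- A symbol makes sense on one level only. An arbitrary linear extension to `S` is harmless, since
  -- only values on that level are used.
  have hext : ∀ j, ∃ σ : S →ₗ[F] N.Gr, σ ∘ₗ (N.level j).subtype = N.symbolLinear j := fun j =>
    LinearMap.exists_extend (N.symbolLinear j)
  choose σ hσ using hext
  refine ⟨Polynomial.lsum (fun l => σ (j + l) ∘ₗ φ.toLinearMap) ∘ₗ
    (lengthHom F n).toLinearMap, fun w h => ?_⟩
  simp only [LinearMap.comp_apply, AlgHom.toLinearMap_apply, lengthHom_monomial,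
    Polynomial.lsum_apply]
  rw [Polynomial.sum_monomial_index _ _ (by simp)]
  exact DFunLike.congr_fun (hσ (j + w.length)) ⟨_, hφ.monomial_mem_of_le h⟩

/-- The linear map `Q_n → gr S` that sends a product of length `l` and degree at most `j` to the
symbol of its image under `φ` in degree `j + l`. -/
def RaisesDegree.symbolHom (j : ℕ) : Q F n →ₗ[F] N.Gr := (hφ.exists_symbolHom j).choose

theorem RaisesDegree.symbolHom_monomial {j : ℕ} {w : List (Gens n)} (h : degree w ≤ j) :
    hφ.symbolHom j (monomial F w) =
      N.symbol (j + w.length) (φ (monomial F w)) (hφ.monomial_mem_of_le h) :=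
  (hφ.exists_symbolHom j).choose_spec w h

theorem RaisesDegree.symbolHom_mul {i j : ℕ} {a b : Q F n} (ha : a ∈ (filtQ F n).level i)
    (hb : b ∈ (filtQ F n).level j) :
    hφ.symbolHom (i + j) (a * b) = hφ.symbolHom i a * hφ.symbolHom j b := by
  rw [level_filtQ] at ha hb
  induction ha, hb using Submodule.span_induction₂ with
  | mem_mem a b ha hb =>
    obtain ⟨w, hw, rfl⟩ := ha
    obtain ⟨w', hw', rfl⟩ := hb
    have hd : degree (w ++ w') ≤ i + j := (degree_append w w').trans_le (add_le_add hw hw')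
    rw [← monomial_append, hφ.symbolHom_monomial hw, hφ.symbolHom_monomial hw',
      hφ.symbolHom_monomial hd, AlgFiltration.symbol_mul]
    refine AlgFiltration.symbol_congr _ _ _ ?_ ?_
    · rw [List.length_append]
      omega
    · rw [monomial_append, map_mul]
  | zero_left b _ => rw [zero_mul, map_zero, map_zero, zero_mul]
  | zero_right a _ => rw [mul_zero, map_zero, map_zero, mul_zero]
  | add_left a b c _ _ _ h h' => rw [add_mul, map_add, h, h', map_add, add_mul]
  | add_right a b c _ _ _ h h' => rw [mul_add, map_add, h, h', map_add, mul_add]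
  | smul_left c a b _ _ h => rw [smul_mul_assoc, map_smul, h, map_smul, smul_mul_assoc]
  | smul_right c a b _ _ h => rw [mul_smul_comm, map_smul, h, map_smul, mul_smul_comm]

/-- A word of degree at most `j` and length `l` has image in level `j + l`, so its symbol in degree
`j + 1 + l` is zero. -/
theorem RaisesDegree.symbolHom_eq_zero {j : ℕ} {a : Q F n} (ha : a ∈ (filtQ F n).below j) :
    hφ.symbolHom j a = 0 := by
  cases j with
  | zero =>
    have h0 : a = 0 := by simpa [AlgFiltration.below] using ha
    rw [h0, map_zero]
  | succ j =>
    have ha : a ∈ (filtQ F n).level j := ha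
    rw [level_filtQ] at ha
    have hle : Submodule.span F (monomial F '' {w : List (Gens n) | degree w ≤ j}) ≤
        LinearMap.ker (hφ.symbolHom (j + 1)) := by
      rw [Submodule.span_le]
      rintro _ ⟨w, hw, rfl⟩
      have hw : degree w ≤ j := hw
      refine (hφ.symbolHom_monomial (Nat.le_succ_of_le hw)).trans ?_
      exact N.symbol_eq_zero _ (N.mem_below_of_lt
        (by omega : j + w.length < j + 1 + w.length) (hφ.monomial_mem_of_le hw))
    exact hle ha

/-- The homomorphism `gr Q_n → gr S` that sends the symbol of a product of length `l` and degree
`j` to the symbol of its image under `φ` in degree `j + l`. -/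
def RaisesDegree.grHom : GrQ F n →ₐ[F] N.Gr :=
  (filtQ F n).grLift
    (fun j => (filtQ F n).pieceLift (hφ.symbolHom j) fun _ ha => hφ.symbolHom_eq_zero ha)
    ((hφ.symbolHom_monomial (w := []) le_rfl).trans (N.symbol_congr _ N.one_mem rfl (map_one _)))
    fun _ _ _ _ ha hb => hφ.symbolHom_mul ha hb

theorem RaisesDegree.grHom_symbol {j : ℕ} {a : Q F n} (ha : a ∈ (filtQ F n).level j) :
    hφ.grHom ((filtQ F n).symbol j a ha) = hφ.symbolHom j a :=
  (filtQ F n).grLift_symbol _ _ _ ha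

theorem RaisesDegree.grHom_symbol_monomial (w : List (Gens n)) :
    hφ.grHom ((filtQ F n).symbol (degree w) (monomial F w) (PseudoRoots.monomial_mem F le_rfl)) =
      N.symbol (shiftedDegree w) (φ (monomial F w)) (hφ.monomial_mem w) :=
  (hφ.grHom_symbol _).trans (hφ.symbolHom_monomial le_rfl)

theorem RaisesDegree.grHom_rbar {A : Finset (Fin n)} (hA : A.Nonempty) :
    hφ.grHom (rbar F A) = N.symbol (A.card + 1) (φ (r F A)) (hφ A) := by
  have h1 : monomial F [⟨A, hA⟩] = r F A := by simp [monomial]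
  have hd : degree [(⟨A, hA⟩ : Gens n)] = A.card := by simp [degree]
  have h := hφ.grHom_symbol_monomial [⟨A, hA⟩]
  rw [(filtQ F n).symbol_congr _ (r_mem F A) hd h1] at h
  refine h.trans (N.symbol_congr _ _ ?_ (by rw [h1]))
  rw [shiftedDegree, hd, List.length_singleton]

end GrHom

/-- The symbols of a family of products adapted to `shiftedDegree` span `gr Q_n`. -/
theorem span_symbol_monomial {I : Set (List (Gens n))}
    (hI : ∀ w, monomial F w ∈
      Submodule.span F (monomial F '' {x | x ∈ I ∧ shiftedDegree x ≤ shiftedDegree w})) :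
    Submodule.span F (Set.range fun i : I =>
      (filtQ F n).symbol (degree i.1) (monomial F i.1) (monomial_mem F le_rfl)) = ⊤ := by
  refine (filtQ F n).eq_top_of_symbol_mem (fun j => (level_filtQ F j).le) ?_
  rintro j _ ⟨w, hw, rfl⟩
  have hw : degree w ≤ j := hw
  -- Once all words have the length of `w`, the bound on `shiftedDegree` becomes a bound on
  -- `degree`.
  refine (filtQ F n).symbol_mem_of_mem_span ?_ (monomial_mem_span_length (hI w))
  rintro _ ⟨x, ⟨⟨hx, hxw⟩, hl⟩, rfl⟩
  have hxj : degree x ≤ j := by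
    simp only [shiftedDegree] at hxw
    omega
  refine ⟨monomial_mem F hxj, ?_⟩
  rcases hxj.eq_or_lt with rfl | hlt
  · exact Submodule.subset_span ⟨⟨x, hx⟩, rfl⟩
  · rw [(filtQ F n).symbol_eq_zero _ ((filtQ F n).mem_below_of_lt hlt (monomial_mem F le_rfl))]
    exact Submodule.zero_mem _

end PseudoRoots

namespace PseudoRoots

variable {F : Type u} [Field F] {n : ℕ}

/-! ### A basis of `Q_{n+1}(1)` -/

section Independence

variable {ι R : Type*} [Ring R] [Algebra F R] (b : Module.Basis ι F R)

/-- The operator on `⨁ R`, the sum over all lists of indices, that moves a basis vector `b(i)` of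
a summand to the list of indices. -/
def separator : Module.End F (List ι →₀ R) :=
  Finsupp.lsum F fun L => b.constr F fun i => Finsupp.single (i :: L) 1

theorem separator_single (L : List ι) (i : ι) :
    separator b (Finsupp.single L (b i)) = Finsupp.single (i :: L) 1 := by
  rw [separator, Finsupp.lsum_single, Module.Basis.constr_basis]

/-- The action of `Q_{n+1}` on `⨁ R` induced by a homomorphism `Q_n → R`. -/
def separatorHom (f : Q F n →ₐ[F] R) : Q F (n + 1) →ₐ[F] Module.End F (List ι →₀ R) :=
  extend ((Algebra.lsmul F F (List ι →₀ R)).comp f) (separator b)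

theorem separatorHom_shift (f : Q F n →ₐ[F] R) (a : Q F n) :
    separatorHom b f (shift F n a) = Algebra.lsmul F F (List ι →₀ R) (f a) :=
  extend_shift _ _ a

theorem separatorHom_rOne_empty (f : Q F n →ₐ[F] R) :
    separatorHom b f (rOne F (∅ : Finset (Fin n))) = separator b :=
  extend_rOne_empty _ _

/-- Read the word from the right: each `b i` turns the entry `1` into `b i`, and each separator
records `i` in the list and resets the entry to `1`. -/
theorem sepWord_apply_single (i : ι) (L : List ι) :
    sepWord (fun i => Algebra.lsmul F F (List ι →₀ R) (b i)) (separator b) (i, L)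
      (Finsupp.single [] 1) = Finsupp.single L (b i) := by
  have hb : ∀ (L : List ι) (i : ι), Algebra.lsmul F F (List ι →₀ R) (b i)
      (Finsupp.single L 1) = Finsupp.single L (b i) := fun L i => by simp
  rw [sepWord, Module.End.mul_apply]
  suffices h : (L.map fun i => separator b * Algebra.lsmul F F (List ι →₀ R) (b i)).prod
      (Finsupp.single [] 1) = Finsupp.single L 1 by
    rw [h, hb]
  induction L with
  | nil => rfl
  | cons i L ih =>
    rw [List.map_cons, List.prod_cons, Module.End.mul_apply, ih, Module.End.mul_apply, hb,
      separator_single]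

/-- Evaluating the action at the vector `1` over the empty list sends distinct words to distinct
members of the standard basis of `List ι →₀ R`. -/
theorem linearIndependent_sepWord {S : Type*} [Ring S] [Algebra F S] (φ : R →ₐ[F] S) (x : S)
    (χ : S →ₐ[F] Module.End F (List ι →₀ R)) (hφ : ∀ a, χ (φ a) = Algebra.lsmul F F _ a)
    (hx : χ x = separator b) : LinearIndependent F (sepWord (fun i => φ (b i)) x) := by
  refine LinearIndependent.of_comp (LinearMap.applyₗ (Finsupp.single [] 1) ∘ₗ χ.toLinearMap) ?_
  have h : (LinearMap.applyₗ (Finsupp.single [] 1) ∘ₗ χ.toLinearMap) ∘ sepWord (fun i => φ (b i)) x =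
      (Finsupp.basis fun _ : List ι => b) ∘ fun k : ι × List ι => ⟨k.2, k.1⟩ := by
    funext ⟨i, L⟩
    change χ (sepWord (fun i => φ (b i)) x (i, L)) (Finsupp.single [] 1) = _
    rw [map_sepWord, hx]
    simp only [hφ]
    rw [sepWord_apply_single]
    simp
  rw [h]
  refine (Finsupp.basis fun _ : List ι => b).linearIndependent.comp _ ?_
  rintro ⟨i, L⟩ ⟨i', L'⟩ h
  simpa [and_comm] using h

end Independence

/-! ### Levels as spans of words with separators -/

section Span

variable {I : Set (List (Gens n))} {S : Type u} [Ring S] [Algebra F S] (φ : Q F n →ₐ[F] S) (x : S)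

/-- The span of the words of weight at most `j` in the images of words of `I`, with separator
`x`. -/
def wordLevel (I : Set (List (Gens n))) (j : ℕ) : Submodule F S :=
  Submodule.span F (sepWord (fun i : I => φ (monomial F i.1)) x ''
    {k | sepWeight (fun i => shiftedDegree i.1) k ≤ j})

variable (hI : ∀ w, monomial F w ∈
  Submodule.span F (monomial F '' {x | x ∈ I ∧ shiftedDegree x ≤ shiftedDegree w}))
include hI

/-- Only the first block has to be rewritten in the words of `I`, and `hI` does this without raising
the weight. -/
theorem map_monomial_mul_mem (w : List (Gens n)) (L : List I) {j : ℕ}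
    (hj : shiftedDegree w + (L.map fun i => 1 + shiftedDegree i.1).sum ≤ j) :
    φ (monomial F w) * (L.map fun i => x * φ (monomial F i.1)).prod ∈ wordLevel φ x I j := by
  refine map_mul_prod_mem _ _ ?_ (hI w)
  rintro _ ⟨y, ⟨hy, hyw⟩, rfl⟩
  exact Submodule.subset_span ⟨(⟨y, hy⟩, L), (Nat.add_le_add_right hyw _).trans hj, rfl⟩

theorem one_mem_wordLevel : 1 ∈ wordLevel φ x I 0 := by
  have h := map_monomial_mul_mem φ x hI [] [] (j := 0) (by simp [shiftedDegree, degree])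
  have h1 : φ (monomial F []) = 1 := map_one _
  rwa [h1, one_mul] at h

/-- The summand `x` starts a new empty block and costs `1`; the summand `φ (r F A)` prepends a
letter of weight `|A| + 1` to the first block. -/
theorem add_mul_mem_wordLevel (A : Finset (Fin n)) {j : ℕ} {s : S} (hs : s ∈ wordLevel φ x I j) :
    (x + φ (r F A)) * s ∈ wordLevel φ x I (A.card + 1 + j) := by
  have hle : wordLevel φ x I j ≤
      (wordLevel φ x I (A.card + 1 + j)).comap (LinearMap.mulLeft F (x + φ (r F A))) := by
    rw [wordLevel, Submodule.span_le]
    rintro _ ⟨⟨i, L⟩, hk, rfl⟩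
    have hk : shiftedDegree i.1 + (L.map fun i => 1 + shiftedDegree i.1).sum ≤ j := hk
    change (x + φ (r F A)) * (φ (monomial F i.1) *
      (L.map fun i => x * φ (monomial F i.1)).prod) ∈ wordLevel φ x I (A.card + 1 + j)
    rw [add_mul]
    refine Submodule.add_mem _ ?_ ?_
    · have h := map_monomial_mul_mem φ x hI [] (i :: L) (j := A.card + 1 + j) (by
        simp only [shiftedDegree, degree, List.map_cons, List.sum_cons, List.map_nil, List.sum_nil,
          List.length_nil] at hk ⊢
        omega)
      have h1 : φ (monomial F []) = 1 := map_one _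
      rwa [h1, one_mul, List.map_cons, List.prod_cons, mul_assoc] at h
    · by_cases hne : A.Nonempty
      · have h := map_monomial_mul_mem φ x hI (⟨A, hne⟩ :: i.1) L (j := A.card + 1 + j) (by
          simp only [shiftedDegree, degree, List.map_cons, List.sum_cons, List.length_cons] at hk ⊢
          omega)
        have h1 : monomial F (⟨A, hne⟩ :: i.1) = r F A * monomial F i.1 := rfl
        rwa [h1, map_mul, mul_assoc] at h
      · rw [Finset.not_nonempty_iff_eq_empty.1 hne, r_empty, map_zero, zero_mul]
        exact Submodule.zero_mem _
  exact hle hs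

theorem extend_monomial_mem (w : List (Gens (n + 1))) :
    extend φ x (monomial F w) ∈ wordLevel φ x I (degree w) := by
  induction w with
  | nil =>
    have h : extend φ x (monomial F []) = 1 := map_one _
    rw [h]
    exact one_mem_wordLevel φ x hI
  | cons A w ih =>
    have h1 : monomial F (A :: w) = r F A.1 * monomial F w := rfl
    -- The letter `A` becomes `x + φ (r F (dropMin A))`, and the least element lost by `dropMin`
    -- pays for `x`.
    have hd : degree (A :: w) = (dropMin A.1).card + 1 + degree w := by
      rw [card_dropMin A.2]
      simp [degree]
    rw [h1, map_mul, extend_r _ _ A.2, hd]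
    exact add_mul_mem_wordLevel φ x hI _ ih

theorem extend_mem_wordLevel {j : ℕ} {a : Q F (n + 1)} (ha : a ∈ (filtQ F (n + 1)).level j) :
    extend φ x a ∈ wordLevel φ x I j := by
  rw [level_filtQ] at ha
  have h := Submodule.mem_map_of_mem (f := (extend φ x).toLinearMap) ha
  rw [AlgHom.toLinearMap_apply, Submodule.map_span] at h
  refine Submodule.span_le.2 ?_ h
  rintro _ ⟨_, ⟨w, hw, rfl⟩, rfl⟩
  have hw : degree w ≤ j := hw
  refine Submodule.span_mono (Set.image_mono fun k hk => ?_) (extend_monomial_mem φ x hI w)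
  have hk : sepWeight (fun i : I => shiftedDegree i.1) k ≤ degree w := hk
  exact hk.trans hw

end Span

/-! ### The associated graded algebra of `Q_{n+1}(1)` -/

section Main

variable {S : Type u} [Ring S] [Algebra F S] {N : AlgFiltration F S} {φ : Q F n →ₐ[F] S} {x : S}

/-- The comparison homomorphism `gr Q_n * F[X] → gr S`. -/
def RaisesDegree.freeProdHom (hφ : RaisesDegree N φ) (hx : x ∈ N.level 1) :
    FreeProd F (GrQ F n) (Polynomial F) →ₐ[F] N.Gr :=
  FreeProd.lift hφ.grHom (Polynomial.aeval (N.symbol 1 x hx))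

/-- Here `hN` makes the words span each level of `N`, and `hχ` makes them independent. Both sides
are then compared word by word. -/
theorem RaisesDegree.freeProdHom_bijective (hφ : RaisesDegree N φ) (hx : x ∈ N.level 1)
    (hN : ∀ j, ∀ s ∈ N.level j, ∃ a ∈ (filtQ F (n + 1)).level j, extend φ x a = s)
    (hχ : ∀ {ι : Type} (b : Module.Basis ι F (Q F n)),
      ∃ χ : S →ₐ[F] Module.End F (List ι →₀ Q F n),
        (∀ a, χ (φ a) = Algebra.lsmul F F _ a) ∧ χ x = separator b) :
    Function.Bijective (hφ.freeProdHom hx) := by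
  obtain ⟨I, b, hb, hI⟩ := exists_adapted_basis F n
  have hlev : ∀ j, N.level j = wordLevel φ x I j := by
    intro j
    refine le_antisymm (fun s hs => ?_) (Submodule.span_le.2 ?_)
    · obtain ⟨a, ha, rfl⟩ := hN j s hs
      exact extend_mem_wordLevel φ x hI ha
    · rintro _ ⟨k, hk, rfl⟩
      exact N.mono hk (N.sepWord_mem (fun i => hφ.monomial_mem i.1) hx k)
  obtain ⟨χ, hχφ, hχx⟩ := hχ b
  have hli := linearIndependent_sepWord b φ x χ hχφ hχx
  simp only [hb] at hli
  set W := sepWord (fun i : I => FreeProd.inl F (GrQ F n) (Polynomial F)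
    ((filtQ F n).symbol (degree i.1) (monomial F i.1) (PseudoRoots.monomial_mem F le_rfl)))
    (FreeProd.inr F (GrQ F n) (Polynomial F) Polynomial.X)
  have hW : Submodule.span F (Set.range W) = ⊤ :=
    FreeProd.span_sepWord (span_symbol_monomial F hI)
  have hEW : ∀ k, hφ.freeProdHom hx (W k) =
      N.symbol (sepWeight (fun i => shiftedDegree i.1) k) _ (N.mem_level_of_adapted hlev k) := by
    intro k
    rw [map_sepWord]
    simp only [freeProdHom, FreeProd.lift_inl, FreeProd.lift_inr, Polynomial.aeval_X,
      hφ.grHom_symbol_monomial]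
    exact N.sepWord_symbol _ _ k
  have hsli := N.linearIndependent_symbol_of_adapted hli hlev
  have hsspan := N.span_symbol_of_adapted hlev
  have hEc : ∀ c, hφ.freeProdHom hx (Finsupp.linearCombination F W c) =
      Finsupp.linearCombination F _ c := fun c =>
    (Finsupp.apply_linearCombination F (hφ.freeProdHom hx).toLinearMap W c).trans
      (congrArg (fun f => Finsupp.linearCombination F f c) (funext hEW))
  have hWs : Function.Surjective (Finsupp.linearCombination F W) := by
    rw [← LinearMap.range_eq_top, Finsupp.range_linearCombination, hW]
  constructor
  · intro y z hyz
    obtain ⟨c, rfl⟩ := hWs y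
    obtain ⟨d, rfl⟩ := hWs z
    rw [hEc, hEc] at hyz
    -- Spanning by `W` suffices: its independence is inherited from that of the image symbols.
    rw [hsli hyz]
  · intro y
    have hs := LinearMap.range_eq_top.1 ((Finsupp.range_linearCombination F).trans hsspan)
    obtain ⟨c, rfl⟩ := hs y
    exact ⟨_, hEc c⟩

theorem liftSub_raisesDegree {p : Finset (Fin n) → S} (h)
    (hp : ∀ A, p A ∈ N.level (A.card + 1)) : RaisesDegree N (liftSub (F := F) p h) := by
  intro A
  rw [liftSub_r]
  exact Submodule.sub_mem _ (hp A) (N.mono (by simp) (hp ∅))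

/-- The correction `p ∅` lies in level `1`, which is below degree `A.card + 1` when `A` is nonempty,
so it does not affect the symbol. -/
theorem grHom_rbar_of_liftSub {p : Finset (Fin n) → S} (h) (hp : ∀ A, p A ∈ N.level (A.card + 1))
    {A : Finset (Fin n)} (hA : A.Nonempty) :
    (liftSub_raisesDegree h hp).grHom (rbar F A) = N.symbol (A.card + 1) (p A) (hp A) := by
  refine (RaisesDegree.grHom_rbar _ hA).trans (N.symbol_eq_of_sub_mem _ _ ?_)
  rw [liftSub_r, sub_sub_cancel_left]
  exact Submodule.neg_mem _ (N.mono (Finset.card_pos.2 hA) (hp ∅))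

end Main

theorem rOne_mem (A : Finset (Fin n)) : rOne F A ∈ (filtQOne F (n + 1)).level (A.card + 1) := by
  rw [← card_delta]
  exact r_mem F (delta A)

end PseudoRoots

/-! ### The comparison map for `Q_{n+1}(1)` -/

namespace PseudoRoots

variable {F : Type u} [Field F] {n : ℕ}

theorem shift_raisesDegree : RaisesDegree (filtQOne F (n + 1)) (shift F n) :=
  liftSub_raisesDegree (n := n) (p := rOne F (n := n)) (rOne_rel (n := n)) (rOne_mem (n := n))

theorem grHom_shift_rbar {A : Finset (Fin n)} (hA : A.Nonempty) :
    (shift_raisesDegree (F := F) (n := n)).grHom (rbar F A) =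
      (filtQOne F (n + 1)).symbol (A.card + 1) (rOne F A) (rOne_mem A) :=
  grHom_rbar_of_liftSub (n := n) (p := rOne F (n := n)) (rOne_rel (n := n)) (rOne_mem (n := n)) hA

variable (F n) in
/-- The comparison homomorphism `gr Q_n * F[X] → gr Q_{n+1}(1)`. -/
def comparison : FreeProd F (GrQ F n) (Polynomial F) →ₐ[F] GrQOne F (n + 1) :=
  RaisesDegree.freeProdHom (n := n) (x := rOne F (∅ : Finset (Fin n)))
    (shift_raisesDegree (F := F) (n := n)) (rOne_mem (n := n) ∅)

theorem comparison_bijective : Function.Bijective (comparison F n) :=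
  RaisesDegree.freeProdHom_bijective (n := n) (x := rOne F (∅ : Finset (Fin n)))
    (shift_raisesDegree (F := F) (n := n)) (rOne_mem (n := n) ∅)
    -- `extend` for `shift` and `rOne F ∅` is `retraction`, so `s` serves as its own preimage, at
    -- the same level.
    (fun _ s hs => ⟨s, hs, retraction_coe (n := n) s⟩) fun b =>
      ⟨(separatorHom (n := n) b (AlgHom.id F (Q F n))).comp (QOne F (n + 1)).val,
        separatorHom_shift (n := n) b (AlgHom.id F (Q F n)),
        separatorHom_rOne_empty (n := n) b (AlgHom.id F (Q F n))⟩

end PseudoRoots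

open PseudoRoots in
theorem lemma3p5 (F : Type*) [Field F] (n : ℕ) :
    ∃ e : FreeProd F (PseudoRoots.GrQ F n) (Polynomial F) ≃ₐ[F] PseudoRoots.GrQOne F (n + 1),
      (∀ A : Finset (Fin n), A.Nonempty →
        e (FreeProd.inl F (PseudoRoots.GrQ F n) (Polynomial F) (PseudoRoots.rbar F A)) =
          PseudoRoots.rbarOne F (PseudoRoots.delta A) (PseudoRoots.zero_mem_delta A)) ∧
      e (FreeProd.inr F (PseudoRoots.GrQ F n) (Polynomial F) Polynomial.X) =
        PseudoRoots.rbarOne F {0} (Finset.mem_singleton_self 0) := by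
  refine ⟨AlgEquiv.ofBijective (comparison F n) comparison_bijective, fun A hA => ?_, ?_⟩
  · refine (FreeProd.lift_inl _ _ _).trans ((grHom_shift_rbar hA).trans ?_)
    exact (filtQOne F (n + 1)).symbol_congr _ _ (card_delta A).symm rfl
  · refine (FreeProd.lift_inr _ _ _).trans ((Polynomial.aeval_X _).trans ?_)
    exact (filtQOne F (n + 1)).symbol_congr _ _ rfl (Subtype.ext (congrArg (r F) delta_empty))

end
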